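/- Let $A\in\mathbb{R}^{n\times d}$, let $S\in\{0,1\}^{n\times d}$ have at most $s$ nonzero entries in each row, and let $m\ge s+2$. Write $\circ$ for the entrywise product, $\|\cdot\|_F$ for the Frobenius norm and $M^\dagger$ for the Moore–Penrose pseudoinverse of a matrix $M$. Consider the following algorithm, which accesses $A$ only through matrix-vector product queries $x\mapsto Ax$. It draws a $d\times m$ matrix $G$ with independent standard normal entries and computes $Z=AG$ by querying the columns of $G$. For each row $i$ it lets $S_i=\{j : S_{ij}=1\}$, lets $z_i\in\mathbb{R}^m$ be the $i$-th row of $Z$ (as a column vector), lets $G_i$ be the $m\times|S_i|$ matrix whose transpose consists of the rows of $G$ with index in $S_i$, and computes the least-squares solution $\tilde a_i=G_i^\dagger z_i$. It returns the $n\times d$ matrix $\widetilde A$ whose $i$-th row has the entries of $\tilde a_i$ in the positions $S_i$ and $0$ elsewhere. Then the algorithm makes exactly $m$ matrix-vector queries, its output satisfies $\mathbb{E}[\widetilde A]=S\circ A$, and $$\mathbb{E}\left[\|S\circ A-\widetilde A\|_F^2\right]\le \frac{s}{m-s-1}\,\|A-S\circ A\|_F^2 .$$ Equality holds in this inequality if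 every row of $S$ has exactly $s$ nonzero entries. -/

import Mathlib

open MeasureTheory ProbabilityTheory
open scoped Matrix Matrix.Norms.Frobenius

/-! ### The Moore-Penrose pseudoinverse of a real matrix -/

/-- The four Penrose conditions: `X` is a Moore-Penrose pseudoinverse of `M`. -/
structure IsPseudoinverse {ι κ : Type*} [Fintype ι] [Fintype κ]
    (M : Matrix ι κ ℝ) (X : Matrix κ ι ℝ) : Prop where
  mul_mul_self : M * X * M = M
  self_mul_mul : X * M * X = X
  left_symm : (M * X)ᵀ = M * X
  right_symm : (X * M)ᵀ = X * M

theorem IsPseudoinverse.unique {ι κ : Type*} [Fintype ι] [Fintype κ]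
    {M : Matrix ι κ ℝ} {X Y : Matrix κ ι ℝ}
    (hX : IsPseudoinverse M X) (hY : IsPseudoinverse M Y) : X = Y := by
  have h1 : M * X = M * Y := by
    calc M * X = (M * Y * M) * X := by rw [hY.mul_mul_self]
      _ = (M * Y) * (M * X) := by simp only [Matrix.mul_assoc]
      _ = (M * Y)ᵀ * (M * X)ᵀ := by rw [hY.left_symm, hX.left_symm]
      _ = ((M * X * M) * Y)ᵀ := by
          rw [← Matrix.transpose_mul]; simp only [Matrix.mul_assoc]
      _ = M * Y := by rw [hX.mul_mul_self, hY.left_symm]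
  have h2 : X * M = Y * M := by
    calc X * M = X * (M * Y * M) := by rw [hY.mul_mul_self]
      _ = (X * M) * (Y * M) := by simp only [Matrix.mul_assoc]
      _ = (X * M)ᵀ * (Y * M)ᵀ := by rw [hX.right_symm, hY.right_symm]
      _ = (Y * (M * X * M))ᵀ := by
          rw [← Matrix.transpose_mul]; simp only [Matrix.mul_assoc]
      _ = Y * M := by rw [hX.mul_mul_self, hY.right_symm]
  calc X = X * M * X := hX.self_mul_mul.symm
    _ = Y * M * Y := by rw [h2, Matrix.mul_assoc, h1, Matrix.mul_assoc]
    _ = Y := hY.self_mul_mul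

theorem exists_isPseudoinverse {ι κ : Type*} [Fintype ι] [Fintype κ]
    (M : Matrix ι κ ℝ) : ∃ X, IsPseudoinverse M X := by
  classical
  -- a symmetric generalized inverse `C` of `Mᵀ * M`, from its spectral decomposition
  obtain ⟨C, hC, hBC, hBCB, hCBC⟩ : ∃ C : Matrix κ κ ℝ, Cᵀ = C ∧
      (Mᵀ * M) * C = C * (Mᵀ * M) ∧ (Mᵀ * M) * C * (Mᵀ * M) = Mᵀ * M ∧
      C * (Mᵀ * M) * C = C := by
    have hB : (Mᵀ * M).IsHermitian := by
      simp [Matrix.IsHermitian, Matrix.conjTranspose_eq_transpose_of_trivial]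
    obtain ⟨U, e, hU, hBe⟩ : ∃ (U : Matrix κ κ ℝ) (e : κ → ℝ),
        Uᵀ * U = 1 ∧ Mᵀ * M = U * Matrix.diagonal e * Uᵀ := by
      refine ⟨hB.eigenvectorUnitary, hB.eigenvalues, ?_, ?_⟩
      · have := Unitary.coe_star_mul_self hB.eigenvectorUnitary
        rwa [Matrix.star_eq_conjTranspose,
          Matrix.conjTranspose_eq_transpose_of_trivial] at this
      · have := hB.spectral_theorem
        rw [Unitary.conjStarAlgAut_apply, Matrix.star_eq_conjTranspose,
          Matrix.conjTranspose_eq_transpose_of_trivial] at this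
        exact this
    have key : ∀ a b : κ → ℝ, (U * Matrix.diagonal a * Uᵀ) * (U * Matrix.diagonal b * Uᵀ)
        = U * Matrix.diagonal (fun k => a k * b k) * Uᵀ := by
      intro a b
      rw [← Matrix.diagonal_mul_diagonal]
      calc _ = U * Matrix.diagonal a * (Uᵀ * U) * Matrix.diagonal b * Uᵀ := by
            simp only [Matrix.mul_assoc]
        _ = _ := by rw [hU, Matrix.mul_one]; simp only [Matrix.mul_assoc]
    refine ⟨U * Matrix.diagonal (fun k => (e k)⁻¹) * Uᵀ, ?_, ?_, ?_, ?_⟩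
    · simp [Matrix.transpose_mul, Matrix.mul_assoc]
    · rw [hBe, key, key]; simp only [mul_comm]
    · rw [hBe, key, key]; simp only [mul_inv_mul_cancel]
    · rw [hBe, key, key]
      congr; funext k
      by_cases h : e k = 0 <;> simp [h]
  have hMCB : M * C * (Mᵀ * M) = M := by
    rw [← sub_eq_zero, ← Matrix.conjTranspose_mul_self_eq_zero,
      Matrix.conjTranspose_eq_transpose_of_trivial, Matrix.transpose_sub]
    have h1 : (M * C * (Mᵀ * M))ᵀ = (Mᵀ * M) * C * Mᵀ := by
      simp only [Matrix.transpose_mul, hC, Matrix.transpose_transpose, Matrix.mul_assoc]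
    rw [h1, Matrix.sub_mul, Matrix.mul_sub, Matrix.mul_sub]
    have h2 : (Mᵀ * M) * C * Mᵀ * (M * C * (Mᵀ * M)) = Mᵀ * M := by
      calc _ = ((Mᵀ * M) * C * (Mᵀ * M)) * C * (Mᵀ * M) := by simp only [Matrix.mul_assoc]
        _ = _ := by rw [hBCB, hBCB]
    have h3 : (Mᵀ * M) * C * Mᵀ * M = Mᵀ * M := by
      rw [Matrix.mul_assoc _ Mᵀ M, hBCB]
    have h4 : Mᵀ * (M * C * (Mᵀ * M)) = Mᵀ * M := by
      calc _ = (Mᵀ * M) * C * (Mᵀ * M) := by simp only [Matrix.mul_assoc]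
        _ = _ := hBCB
    rw [h2, h3, h4]; simp
  refine ⟨C * Mᵀ, ?_, ?_, ?_, ?_⟩
  · rw [← Matrix.mul_assoc, Matrix.mul_assoc]; exact hMCB
  · calc C * Mᵀ * M * (C * Mᵀ) = (C * (Mᵀ * M) * C) * Mᵀ := by simp only [Matrix.mul_assoc]
      _ = _ := by rw [hCBC]
  · simp only [Matrix.transpose_mul, hC, Matrix.transpose_transpose, Matrix.mul_assoc]
  · rw [Matrix.mul_assoc, ← hBC]
    simp only [Matrix.transpose_mul, hC, Matrix.transpose_transpose]
    rw [← hBC]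

/-- The Moore-Penrose pseudoinverse `M†`: the unique matrix satisfying the Penrose conditions. -/
noncomputable def pinv {ι κ : Type*} [Fintype ι] [Fintype κ] (M : Matrix ι κ ℝ) :
    Matrix κ ι ℝ :=
  Classical.choose (exists_isPseudoinverse M)

theorem pinv_spec {ι κ : Type*} [Fintype ι] [Fintype κ] (M : Matrix ι κ ℝ) :
    IsPseudoinverse M (pinv M) :=
  Classical.choose_spec (exists_isPseudoinverse M)

/-! ### Algorithms with matrix-vector query access -/

/-- A (possibly adaptive) algorithm that can access an unknown `n × d` real matrix only through
matrix-vector product queries: it either stops with an output, or submits a vector `x` and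
continues depending on the answer. -/
inductive MatVecAlg (n d : ℕ) (α : Type) : Type where
  | ret (a : α) : MatVecAlg n d α
  | query (x : Fin d → ℝ) (next : (Fin n → ℝ) → MatVecAlg n d α) : MatVecAlg n d α

namespace MatVecAlg

/-- The output when the unknown matrix is `A`, so that the query `x` is answered by `A *ᵥ x`. -/
def output {n d : ℕ} {α : Type} (A : Matrix (Fin n) (Fin d) ℝ) : MatVecAlg n d α → α
  | ret a => a
  | query x next => output A (next (A *ᵥ x))

/-- The number of matrix-vector queries made when the unknown matrix is `A`. -/
def queryCount {n d : ℕ} {α : Type} (A : Matrix (Fin n) (Fin d) ℝ) : MatVecAlg n d α → ℕ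
  | ret _ => 0
  | query x next => queryCount A (next (A *ᵥ x)) + 1

/-- Query the columns of `G` one after the other, collect the answers as the columns of a
matrix `Z`, and return `post Z`. -/
def queryColumns {n d : ℕ} {α : Type} : (m : ℕ) → (G : Matrix (Fin d) (Fin m) ℝ) →
    (post : Matrix (Fin n) (Fin m) ℝ → α) → MatVecAlg n d α
  | 0, _, post => ret (post (Matrix.of fun _ k => k.elim0))
  | m + 1, G, post => query (fun j => G j 0) fun y =>
      queryColumns m (G.submatrix id Fin.succ) fun Z =>
        post (Matrix.of fun i => Fin.cons (y i) (Z i))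

/-- The collected answers form the product `A * G`. -/
theorem output_queryColumns {n d : ℕ} {α : Type} (A : Matrix (Fin n) (Fin d) ℝ) (m : ℕ)
    (G : Matrix (Fin d) (Fin m) ℝ) (post : Matrix (Fin n) (Fin m) ℝ → α) :
    (queryColumns m G post).output A = post (A * G) := by
  induction m with
  | zero =>
    simp only [queryColumns, output]
    congr 1
    ext i k
    exact k.elim0
  | succ m ih =>
    simp only [queryColumns, output]
    rw [ih]
    congr 1
    ext i k
    refine Fin.cases ?_ (fun k => ?_) k <;> simp [Matrix.mul_apply, Matrix.mulVec, dotProduct]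

end MatVecAlg

/-! ### Fixed-sparse-matrix recovery -/

/-- `S_i = {j : S_{ij} = 1}`. -/
noncomputable def rowSupport {n d : ℕ} (S : Matrix (Fin n) (Fin d) ℝ) (i : Fin n) :
    Finset (Fin d) :=
  Finset.univ.filter fun j => S i j = 1

/-- The `m × |S_i|` matrix `G_i`, whose transpose consists of the rows of `G` in `S_i`. -/
noncomputable def rowBlock {n d m : ℕ} (S : Matrix (Fin n) (Fin d) ℝ)
    (G : Matrix (Fin d) (Fin m) ℝ) (i : Fin n) : Matrix (Fin m) (rowSupport S i) ℝ :=
  (G.submatrix (fun j : rowSupport S i => (j : Fin d)) id)ᵀ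

/-- Row by row: the entries of row `i` in `S_i` are those of `G_i† z_i`, where `z_i` is the
`i`-th row of `Z`; all other entries are `0`. -/
noncomputable def solveRows {n d m : ℕ} (S : Matrix (Fin n) (Fin d) ℝ)
    (G : Matrix (Fin d) (Fin m) ℝ) (Z : Matrix (Fin n) (Fin m) ℝ) :
    Matrix (Fin n) (Fin d) ℝ :=
  Matrix.of fun i j =>
    if h : j ∈ rowSupport S i then (pinv (rowBlock S G i) *ᵥ Z i) ⟨j, h⟩ else 0

/-- The recovery algorithm with sketching matrix `G`: compute `Z = A * G` with one query for each
column of `G`, then solve the least-squares problem of each row. -/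
noncomputable def fixedSparseRecovery {n d m : ℕ} (S : Matrix (Fin n) (Fin d) ℝ)
    (G : Matrix (Fin d) (Fin m) ℝ) : MatVecAlg n d (Matrix (Fin n) (Fin d) ℝ) :=
  MatVecAlg.queryColumns m G (solveRows S G)

/-- The random `d × m` matrix `G` has independent standard normal entries. -/
def IsGaussianMatrix {Ω : Type*} [MeasurableSpace Ω] {d m : ℕ} (P : Measure Ω)
    (G : Ω → Matrix (Fin d) (Fin m) ℝ) : Prop :=
  (∀ j k, HasLaw (fun ω => G ω j k) (gaussianReal 0 1) P) ∧
    iIndepFun (fun (p : Fin d × Fin m) ω => G ω p.1 p.2) P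

/-! Let `X l` be the rows of `G`, independent standard Gaussian vectors in ℝ^m, and let `T = S_i`.
Row `i` of `A * G` is `∑ l, A i l • X l`. Almost surely the `X l` with `l ∈ T` are linearly
independent, so the pseudoinverse is a left inverse and its rows are the dual vectors `p_j` of this
family. Coefficient `j` is then recovered up to the error `⟪p_j, ∑ l ∉ T, A i l • X l⟫`
(`solveRows_mul_apply`).

As `p_j` depends only on the rows in `T`, the error given these rows is centred with variance
`‖p_j‖² ∑ l ∉ T, A i l ^ 2`. Geometrically, `‖p_j‖⁻¹` is the distance of `X j` from the span of the
other `|T| - 1` vectors (`norm_sq_dualVector`). Given those vectors, its square is chi-square with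
`r = m - |T| + 1` degrees of freedom, and the mean of its inverse is `1 / (r - 2) = 1 / (m - |T| -
1)` (`lintegral_norm_sq_dualVector`). Summing over `j ∈ T` gives the factor `|T| / (m - |T| - 1)`,
which increases with `|T| ≤ s`. -/

/-! ### Inverse moment of the chi-square distribution -/

theorem integral_exp_neg_mul_sq_gaussianReal {t : ℝ} (ht : 0 < t) :
    ∫ x, Real.exp (-t * x ^ 2) ∂(gaussianReal 0 1) = (√(1 + 2 * t))⁻¹ := by
  rw [integral_gaussianReal_eq_integral_smul one_ne_zero]
  have h : ∀ x : ℝ, gaussianPDFReal 0 1 x • Real.exp (-t * x ^ 2)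
      = (√(2 * Real.pi))⁻¹ * Real.exp (-(t + 1 / 2) * x ^ 2) := by
    intro x
    simp only [gaussianPDFReal, NNReal.coe_one, mul_one, sub_zero, smul_eq_mul]
    rw [mul_assoc, ← Real.exp_add]
    congr 2
    ring
  simp_rw [h]
  rw [integral_const_mul, integral_gaussian, ← Real.sqrt_inv, ← Real.sqrt_inv,
    ← Real.sqrt_mul (by positivity)]
  congr 1
  field_simp
  ring

theorem lintegral_exp_neg_mul_sum_sq_gaussian (ι : Type*) [Fintype ι] {t : ℝ} (ht : 0 < t) :
    ∫⁻ x : ι → ℝ, ENNReal.ofReal (Real.exp (-t * ∑ i, x i ^ 2))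
      ∂(Measure.pi fun _ => gaussianReal 0 1)
      = ENNReal.ofReal ((√(1 + 2 * t))⁻¹ ^ Fintype.card ι) := by
  rw [← ofReal_integral_eq_lintegral_ofReal]
  · congr 1
    simp_rw [Finset.mul_sum, Real.exp_sum]
    rw [integral_fintype_prod_eq_prod (f := fun _ x => Real.exp (-t * x ^ 2))]
    simp_rw [integral_exp_neg_mul_sq_gaussianReal ht]
    simp
  · refine Integrable.of_bound (C := 1) (Measurable.aestronglyMeasurable (by fun_prop)) (ae_of_all _ fun x => ?_)
    rw [Real.norm_of_nonneg (Real.exp_pos _).le]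
    refine Real.exp_le_one_iff.2 ?_
    have : 0 ≤ ∑ i, x i ^ 2 := Finset.sum_nonneg fun i _ => sq_nonneg _
    nlinarith
  · exact ae_of_all _ fun x => (Real.exp_pos _).le

theorem lintegral_Ioi_exp_neg_mul {y : ℝ} (hy : 0 < y) :
    ∫⁻ t in Set.Ioi (0 : ℝ), ENNReal.ofReal (Real.exp (-t * y)) = ENNReal.ofReal y⁻¹ := by
  have h := integral_exp_mul_Ioi (a := -y) (by linarith) 0
  have h' := integrableOn_exp_mul_Ioi (a := -y) (by linarith) 0
  have e : ∀ t : ℝ, -t * y = -y * t := fun t => by ring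
  simp_rw [e]
  rw [← ofReal_integral_eq_lintegral_ofReal h' (ae_of_all _ fun x => (Real.exp_pos _).le), h]
  simp

theorem lintegral_Ioi_inv_sqrt_pow {r : ℕ} (hr : 3 ≤ r) :
    ∫⁻ t in Set.Ioi (0 : ℝ), ENNReal.ofReal ((√(1 + 2 * t))⁻¹ ^ r)
      = ENNReal.ofReal ((r : ℝ) - 2)⁻¹ := by
  obtain ⟨q, rfl⟩ : ∃ q, r = q + 3 := ⟨r - 3, by omega⟩
  -- An antiderivative of the integrand; with `r = q + 3` its exponent is `r - 2 = q + 1`, and `-F 0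
  -- = 1 / (r - 2)` is the value sought.
  set F : ℝ → ℝ := fun t => -((q : ℝ) + 1)⁻¹ * (√(1 + 2 * t))⁻¹ ^ (q + 1)
  have hd : ∀ t ∈ Set.Ici (0 : ℝ), HasDerivAt F ((√(1 + 2 * t))⁻¹ ^ (q + 3)) t := by
    intro t ht
    have ht : (0 : ℝ) ≤ t := ht
    have hp : 0 < 1 + 2 * t := by linarith
    have h1 : HasDerivAt (fun t : ℝ => 1 + 2 * t) 2 t := by
      simpa using ((hasDerivAt_id t).const_mul 2).const_add 1
    have h2 := ((h1.sqrt hp.ne').inv (Real.sqrt_pos.2 hp).ne').pow (q + 1)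
    have h3 := h2.const_mul (-((q : ℝ) + 1)⁻¹)
    refine h3.congr_deriv ?_
    have hs : √(1 + 2 * t) ≠ 0 := (Real.sqrt_pos.2 hp).ne'
    have hq : (q : ℝ) + 1 ≠ 0 := by positivity
    simp only [Nat.add_sub_cancel, Pi.inv_apply]
    push_cast
    have e : (√(1 + 2 * t))⁻¹ ^ (q + 3) = (√(1 + 2 * t))⁻¹ ^ q * (√(1 + 2 * t))⁻¹ ^ 3 := pow_add _ _ _
    rw [e]
    field_simp
  have hlim : Filter.Tendsto F Filter.atTop (nhds 0) := by
    have h1 : Filter.Tendsto (fun t : ℝ => √(1 + 2 * t)) Filter.atTop Filter.atTop :=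
      Real.tendsto_sqrt_atTop.comp (Filter.tendsto_atTop_add_const_left _ _
        (Filter.tendsto_id.const_mul_atTop (by norm_num)))
    have h2 := (h1.inv_tendsto_atTop.pow (q + 1)).const_mul (-((q : ℝ) + 1)⁻¹)
    simpa [F] using h2
  have hnn : ∀ t ∈ Set.Ioi (0 : ℝ), 0 ≤ (√(1 + 2 * t))⁻¹ ^ (q + 3) := fun t _ => by positivity
  rw [← ofReal_integral_eq_lintegral_ofReal
    (integrableOn_Ioi_deriv_of_nonneg' hd hnn hlim) (ae_of_all _ fun t => by positivity),
    integral_Ioi_of_hasDerivAt_of_nonneg' hd hnn hlim]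
  congr 1
  simp only [F]
  push_cast
  norm_num
  ring

/-- Write `1 / y` as the integral of `exp (-t * y)` over `t > 0` and swap by Tonelli: the Gaussian
integral then factors over coordinates. -/
theorem lintegral_inv_sum_sq_gaussian (ι : Type*) [Fintype ι] (hι : 3 ≤ Fintype.card ι) :
    ∫⁻ x : ι → ℝ, ENNReal.ofReal (∑ i, x i ^ 2)⁻¹ ∂(Measure.pi fun _ => gaussianReal 0 1)
      = ENNReal.ofReal ((Fintype.card ι : ℝ) - 2)⁻¹ := by
  have hne : Nonempty ι := Fintype.card_pos_iff.1 (by omega)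
  have i0 : ι := Classical.arbitrary ι
  -- At `y = 0` the integral over `t` is infinite while `0⁻¹ = 0`, so the origin must be discarded.
  have hae : ∀ᵐ x : ι → ℝ ∂(Measure.pi fun _ => gaussianReal 0 1), x i0 ≠ 0 := by
    have : NullSingletonClass (gaussianReal 0 1) := nullSingletonClass_gaussianReal one_ne_zero
    have h0 : ∀ᵐ y ∂(gaussianReal 0 1), y ≠ 0 := by
      simp [ae_iff]
    exact (measurePreserving_eval (fun _ : ι => gaussianReal 0 1) i0).quasiMeasurePreserving.ae h0
  calc _ = ∫⁻ x : ι → ℝ, (∫⁻ t in Set.Ioi (0 : ℝ),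
          ENNReal.ofReal (Real.exp (-t * ∑ i, x i ^ 2))) ∂(Measure.pi fun _ : ι => gaussianReal 0 1) := by
        refine lintegral_congr_ae (hae.mono fun x hx => (lintegral_Ioi_exp_neg_mul ?_).symm)
        exact Finset.sum_pos' (fun i _ => sq_nonneg _) ⟨i0, Finset.mem_univ _, by positivity⟩
    _ = ∫⁻ t in Set.Ioi (0 : ℝ), ∫⁻ x : ι → ℝ, ENNReal.ofReal (Real.exp (-t * ∑ i, x i ^ 2))
        ∂(Measure.pi fun _ : ι => gaussianReal 0 1) := by
        rw [lintegral_lintegral_swap]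
        exact Measurable.aemeasurable (by fun_prop)
    _ = _ := by
        rw [← lintegral_Ioi_inv_sqrt_pow hι]
        exact setLIntegral_congr_fun measurableSet_Ioi
          fun t ht => lintegral_exp_neg_mul_sum_sq_gaussian ι ht

/-! ### Standard Gaussian vectors and subspaces -/

/-- Characteristic functions agree, since projecting onto `K` does not change inner products with
vectors of `K`. -/
theorem stdGaussian_map_orthogonalProjection {E : Type*} [NormedAddCommGroup E]
    [InnerProductSpace ℝ E] [FiniteDimensional ℝ E] [MeasurableSpace E] [BorelSpace E]
    (K : Submodule ℝ E) :
    (stdGaussian E).map K.orthogonalProjectionOnto = stdGaussian K := by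
  have : IsProbabilityMeasure ((stdGaussian E).map K.orthogonalProjectionOnto) :=
    Measure.isProbabilityMeasure_map (by fun_prop)
  apply Measure.ext_of_charFun
  ext t
  rw [charFun_stdGaussian, charFun_apply, integral_map (by fun_prop) (by fun_prop)]
  have := charFun_stdGaussian (E := E) (t : E)
  rw [charFun_apply] at this
  simpa using this

theorem lintegral_inv_norm_sq_orthogonalProjection {E : Type*} [NormedAddCommGroup E]
    [InnerProductSpace ℝ E] [FiniteDimensional ℝ E] [MeasurableSpace E] [BorelSpace E]
    (K : Submodule ℝ E) (hK : 3 ≤ Module.finrank ℝ K) :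
    ∫⁻ x, ENNReal.ofReal (‖K.orthogonalProjectionOnto x‖ ^ 2)⁻¹ ∂(stdGaussian E)
      = ENNReal.ofReal ((Module.finrank ℝ K : ℝ) - 2)⁻¹ := by
  have h1 : ∫⁻ y, ENNReal.ofReal (‖y‖ ^ 2)⁻¹ ∂(stdGaussian K)
      = ENNReal.ofReal ((Module.finrank ℝ K : ℝ) - 2)⁻¹ := by
    rw [stdGaussian, lintegral_map (by fun_prop) (by fun_prop)]
    have h := lintegral_inv_sum_sq_gaussian (Fin (Module.finrank ℝ K)) (by simpa using hK)
    rw [Fintype.card_fin] at h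
    rw [← h]
    refine lintegral_congr fun x => ?_
    congr 2
    rw [← (stdOrthonormalBasis ℝ K).sum_sq_inner_right]
    refine Finset.sum_congr rfl fun i _ => ?_
    rw [(stdOrthonormalBasis ℝ K).orthonormal.inner_right_fintype]
  rw [← h1, ← stdGaussian_map_orthogonalProjection, lintegral_map (by fun_prop) (by fun_prop)]

/-- A proper subspace lies in the kernel of `⟪v, ·⟫` for some `v ≠ 0`, whose law is a nondegenerate
Gaussian and so has no atom at `0`. -/
theorem stdGaussian_submodule_eq_zero {E : Type*} [NormedAddCommGroup E]
    [InnerProductSpace ℝ E] [FiniteDimensional ℝ E] [MeasurableSpace E] [BorelSpace E]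
    {V : Submodule ℝ E} (hV : V ≠ ⊤) : stdGaussian E (V : Set E) = 0 := by
  obtain ⟨v, hv, hv0⟩ := Submodule.exists_mem_ne_zero_of_ne_bot
    (mt (Submodule.orthogonal_eq_bot_iff (K := V)).1 hV)
  have hL : (stdGaussian E).map (innerSL ℝ v) = gaussianReal 0 (‖v‖ ^ 2).toNNReal := by
    rw [IsGaussian.map_eq_gaussianReal, integral_strongDual_stdGaussian,
      variance_dual_stdGaussian, innerSL_apply_norm]
  have hne : (‖v‖ ^ 2).toNNReal ≠ 0 := by
    simpa using hv0
  have := nullSingletonClass_gaussianReal (μ := 0) hne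
  have h0 : (stdGaussian E).map (innerSL ℝ v) {0} = 0 := by rw [hL]; exact measure_singleton 0
  rw [Measure.map_apply (by fun_prop) (measurableSet_singleton 0)] at h0
  refine measure_mono_null (fun x hx => ?_) h0
  simpa using V.inner_left_of_mem_orthogonal hx hv

/-! ### Conditioning on a block of coordinates -/

section Resampling

variable {ι : Type*} [Fintype ι] [DecidableEq ι] {α : Type*} [MeasurableSpace α]

/-- A substitute for conditioning: taking the coordinates in `T` from one copy and the rest from an
independent copy keeps the law, so Fubini integrates the rest with `T` frozen. -/
theorem measurePreserving_piecewise (ν : Measure α) [IsProbabilityMeasure ν] (T : Finset ι) :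
    MeasurePreserving (fun p : (ι → α) × (ι → α) => T.piecewise p.1 p.2)
      ((Measure.pi fun _ => ν).prod (Measure.pi fun _ => ν)) (Measure.pi fun _ => ν) := by
  have hmeas : Measurable fun p : (ι → α) × (ι → α) => T.piecewise p.1 p.2 := by
    refine measurable_pi_lambda _ fun i => ?_
    by_cases h : i ∈ T <;> simp only [Finset.piecewise, h, if_true, if_false] <;> fun_prop
  refine ⟨hmeas, (Measure.pi_eq fun s hs => ?_).symm⟩
  have hpre : (fun p : (ι → α) × (ι → α) => T.piecewise p.1 p.2) ⁻¹' Set.univ.pi s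
      = (Set.univ.pi (T.piecewise s fun _ => Set.univ)) ×ˢ
        (Set.univ.pi (T.piecewise (fun _ => Set.univ) s)) := by
    ext p
    simp only [Set.mem_preimage, Set.mem_pi, Set.mem_univ, true_imp_iff, Set.mem_prod,
      ← forall_and]
    refine forall_congr' fun i => ?_
    by_cases h : i ∈ T <;> simp [Finset.piecewise, h]
  rw [Measure.map_apply hmeas (MeasurableSet.univ_pi hs), hpre, Measure.prod_prod,
    Measure.pi_pi, Measure.pi_pi, ← Finset.prod_mul_distrib]
  refine Finset.prod_congr rfl fun i _ => ?_
  by_cases h : i ∈ T <;> simp [Finset.piecewise, h]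

theorem lintegral_pi_eq_lintegral_piecewise (ν : Measure α) [IsProbabilityMeasure ν]
    (T : Finset ι) {f : (ι → α) → ENNReal} (hf : Measurable f) :
    ∫⁻ X, f X ∂(Measure.pi fun _ => ν)
      = ∫⁻ X, ∫⁻ Y, f (T.piecewise X Y) ∂(Measure.pi fun _ => ν) ∂(Measure.pi fun _ => ν) := by
  have hmp := measurePreserving_piecewise ν T
  rw [← hmp.lintegral_comp hf]
  exact lintegral_prod _ (hf.comp hmp.measurable).aemeasurable

theorem integral_pi_eq_integral_piecewise (ν : Measure α) [IsProbabilityMeasure ν]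
    (T : Finset ι) {f : (ι → α) → ℝ} (hf : Integrable f (Measure.pi fun _ => ν)) :
    ∫ X, f X ∂(Measure.pi fun _ => ν)
      = ∫ X, ∫ Y, f (T.piecewise X Y) ∂(Measure.pi fun _ => ν) ∂(Measure.pi fun _ => ν) := by
  have hmp := measurePreserving_piecewise ν T
  rw [← hmp.map_eq, integral_map hmp.aemeasurable (by rw [hmp.map_eq]; exact hf.1), hmp.map_eq]
  exact integral_prod _ (hmp.integrable_comp_of_integrable hf)

end Resampling

/-- Add one vector at a time: the earlier ones span a proper subspace, which an independent Gaussian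
vector almost surely avoids. -/
theorem ae_linearIndepOn_pi_stdGaussian {ι : Type*} [Fintype ι] [DecidableEq ι] {E : Type*}
    [NormedAddCommGroup E] [InnerProductSpace ℝ E] [FiniteDimensional ℝ E] [MeasurableSpace E]
    [BorelSpace E] (U : Finset ι) (hU : U.card ≤ Module.finrank ℝ E) :
    ∀ᵐ X : ι → E ∂(Measure.pi fun _ => stdGaussian E), LinearIndepOn ℝ X (U : Set ι) := by
  induction U using Finset.induction_on with
  | empty => simp
  | insert a U ha ih =>
    rw [Finset.card_insert_of_notMem ha] at hU
    have ih := ih (by omega)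
    have hB : MeasurableSet {X : ι → E | LinearIndepOn ℝ X ((insert a U : Finset ι) : Set ι)} := by
      have hc : Continuous fun (X : ι → E) (i : ((insert a U : Finset ι) : Set ι)) => X i := by
        fun_prop
      exact (isOpen_setOfPred_linearIndependent.preimage hc).measurableSet
    have hmp := measurePreserving_piecewise (stdGaussian E) U
    rw [← hmp.map_eq, ae_map_iff hmp.aemeasurable hB,
      Measure.ae_prod_iff_ae_ae (p := fun p : (ι → E) × (ι → E) =>
        LinearIndepOn ℝ (U.piecewise p.1 p.2) ((insert a U : Finset ι) : Set ι))
        (hmp.measurable hB)]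
    filter_upwards [ih] with X hX
    have hspan : Submodule.span ℝ (X '' (U : Set ι)) ≠ ⊤ := by
      classical
      intro h
      have h1 := finrank_span_finset_le_card (R := ℝ) (U.image X)
      rw [Finset.coe_image, Set.finrank, h, finrank_top] at h1
      have := Finset.card_image_le (s := U) (f := X)
      omega
    have h2 : ∀ᵐ y ∂(stdGaussian E), y ∉ Submodule.span ℝ (X '' (U : Set ι)) :=
      compl_mem_ae_iff.2 (stdGaussian_submodule_eq_zero hspan)
    filter_upwards [(measurePreserving_eval (fun _ : ι => stdGaussian E) a).quasiMeasurePreserving.ae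
      h2] with Y hY
    have he : Set.EqOn (U.piecewise X Y) X (U : Set ι) := fun i hi => by simp [Finset.mem_coe.1 hi]
    rw [Finset.coe_insert, linearIndepOn_insert (by simpa using ha), he.image_eq]
    refine ⟨hX.congr he.symm, ?_⟩
    simpa [ha] using hY

/-! ### Pseudoinverses and dual vectors -/

section LeftInverse

variable {ι κ : Type*} [Fintype ι] [Fintype κ] [DecidableEq κ] {M : Matrix ι κ ℝ}

theorem pinv_mul_self_of_linearIndependent (hM : LinearIndependent ℝ M.col) :
    pinv M * M = 1 := by
  have hinj := Matrix.mulVec_injective_iff.2 hM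
  refine Matrix.ext_iff_mulVec.2 fun v => hinj ?_
  rw [Matrix.mulVec_mulVec, ← Matrix.mul_assoc, (pinv_spec M).mul_mul_self, Matrix.one_mulVec]

theorem transpose_mul_self_mul_pinv_mul_transpose (hM : LinearIndependent ℝ M.col) :
    Mᵀ * M * (pinv M * (pinv M)ᵀ) = 1 := by
  have h1 : Mᵀ * M * pinv M = Mᵀ := by
    rw [Matrix.mul_assoc, ← (pinv_spec M).left_symm, ← Matrix.transpose_mul,
      (pinv_spec M).mul_mul_self]
  rw [← Matrix.mul_assoc, h1, ← Matrix.transpose_mul, pinv_mul_self_of_linearIndependent hM,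
    Matrix.transpose_one]

/-- Unlike `pinv`, which comes from a choice, the left-hand side is visibly measurable in `M`. -/
theorem inv_transpose_mul_self_mul_transpose (hM : LinearIndependent ℝ M.col) :
    (Mᵀ * M)⁻¹ * Mᵀ = pinv M := by
  rw [Matrix.inv_eq_right_inv (transpose_mul_self_mul_pinv_mul_transpose hM), Matrix.mul_assoc,
    ← Matrix.transpose_mul, (pinv_spec M).left_symm, ← Matrix.mul_assoc,
    (pinv_spec M).self_mul_mul]

end LeftInverse

/-- The first two hypotheses make `p` a multiple of the projection `q` of `x` onto `Vᗮ`; the third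
forces `p = q / ‖q‖²`. -/
theorem norm_sq_eq_inv_norm_sq_orthogonalProjection {E : Type*} [NormedAddCommGroup E]
    [InnerProductSpace ℝ E] [FiniteDimensional ℝ E] {V : Submodule ℝ E} {x p : E}
    (hpV : p ∈ Vᗮ) (hp : p ∈ Submodule.span ℝ {x} ⊔ V) (hpx : inner ℝ p x = 1) :
    ‖p‖ ^ 2 = (‖Vᗮ.orthogonalProjectionOnto x‖ ^ 2)⁻¹ := by
  obtain ⟨y, hy, v, hv, rfl⟩ := Submodule.mem_sup.1 hp
  obtain ⟨c, rfl⟩ := Submodule.mem_span_singleton.1 hy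
  have hv0 : Vᗮ.orthogonalProjectionOnto v = 0 :=
    Submodule.orthogonalProjectionOnto_orthogonal_apply_eq_zero (by exact hv)
  have hpq : c • x + v = c • (Vᗮ.orthogonalProjectionOnto x : E) := by
    have h := congrArg Subtype.val (Vᗮ.orthogonalProjectionOnto_mem_subspace_eq_self ⟨_, hpV⟩)
    rw [map_add, map_smul, hv0, add_zero] at h
    exact h.symm
  set q : E := (Vᗮ.orthogonalProjectionOnto x : E)
  have hq : inner ℝ q x = ‖q‖ ^ 2 := by
    have := Submodule.inner_orthogonalProjectionOnto_eq_of_mem_left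
      (Vᗮ.orthogonalProjectionOnto x) x
    rw [← real_inner_self_eq_norm_sq]
    exact this.symm
  rw [hpq, inner_smul_left, hq] at hpx
  simp only [conj_trivial] at hpx
  rw [hpq, norm_smul, mul_pow, Real.norm_eq_abs, sq_abs]
  change c ^ 2 * ‖q‖ ^ 2 = (‖q‖ ^ 2)⁻¹
  rw [← one_div, eq_div_iff (right_ne_zero_of_mul_eq_one hpx)]
  linear_combination (c * ‖q‖ ^ 2 + 1) * hpx

section ColumnMatrix

variable {ι : Type*} {m : ℕ}

/-- The matrix whose columns are the vectors `X l`, `l ∈ T`. -/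
def columnMatrix (X : ι → EuclideanSpace ℝ (Fin m)) (T : Finset ι) : Matrix (Fin m) T ℝ :=
  Matrix.of fun k l => X l k

/-- The rows of the left inverse `(MᵀM)⁻¹Mᵀ` of the matrix `M` with columns `X l`, `l ∈ T`. -/
noncomputable def dualVector [DecidableEq ι] (X : ι → EuclideanSpace ℝ (Fin m)) (T : Finset ι)
    (j : T) : EuclideanSpace ℝ (Fin m) :=
  WithLp.toLp 2 ((((columnMatrix X T)ᵀ * columnMatrix X T)⁻¹ * (columnMatrix X T)ᵀ) j)

theorem linearIndependent_col_columnMatrix {X : ι → EuclideanSpace ℝ (Fin m)} {T : Finset ι}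
    (hX : LinearIndepOn ℝ X (T : Set ι)) : LinearIndependent ℝ (columnMatrix X T).col := by
  have h : LinearIndependent ℝ fun l : T => X l := hX
  have := h.map' (WithLp.linearEquiv 2 ℝ (Fin m → ℝ)).toLinearMap (LinearEquiv.ker _)
  exact this

variable [DecidableEq ι]

theorem dualVector_eq_pinv {X : ι → EuclideanSpace ℝ (Fin m)} {T : Finset ι}
    (hX : LinearIndepOn ℝ X (T : Set ι)) (j : T) :
    dualVector X T j = WithLp.toLp 2 (pinv (columnMatrix X T) j) := by
  rw [dualVector, inv_transpose_mul_self_mul_transpose (linearIndependent_col_columnMatrix hX)]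

theorem inner_dualVector {X : ι → EuclideanSpace ℝ (Fin m)} {T : Finset ι}
    (hX : LinearIndepOn ℝ X (T : Set ι)) (j l : T) :
    inner ℝ (dualVector X T j) (X l) = if j = l then 1 else 0 := by
  have h := congrFun (congrFun (pinv_mul_self_of_linearIndependent
    (linearIndependent_col_columnMatrix hX)) j) l
  rw [Matrix.one_apply, Matrix.mul_apply] at h
  rw [dualVector_eq_pinv hX, ← h]
  simp [PiLp.inner_apply, columnMatrix, mul_comm]

theorem dualVector_mem_span (X : ι → EuclideanSpace ℝ (Fin m)) (T : Finset ι) (j : T) :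
    dualVector X T j ∈ Submodule.span ℝ (X '' (T : Set ι)) := by
  have h : dualVector X T j
      = ∑ l : T, ((columnMatrix X T)ᵀ * columnMatrix X T)⁻¹ j l • X l := by
    ext k
    simp [dualVector, Matrix.mul_apply, columnMatrix]
  rw [h]
  exact Submodule.sum_mem _ fun l _ =>
    Submodule.smul_mem _ _ (Submodule.subset_span ⟨l, l.2, rfl⟩)

theorem norm_sq_dualVector {X : ι → EuclideanSpace ℝ (Fin m)} {T : Finset ι}
    (hX : LinearIndepOn ℝ X (T : Set ι)) (j : T) :
    ‖dualVector X T j‖ ^ 2 = (‖(Submodule.span ℝ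
      (X '' (T.erase j : Set ι)))ᗮ.orthogonalProjectionOnto (X j)‖ ^ 2)⁻¹ := by
  refine norm_sq_eq_inv_norm_sq_orthogonalProjection ?_ ?_ (by simp [inner_dualVector hX])
  · rw [Submodule.mem_orthogonal']
    intro u hu
    refine Submodule.span_induction (p := fun u _ => inner ℝ (dualVector X T j) u = 0)
      ?_ (by simp) (fun x y _ _ hx hy => by rw [inner_add_right, hx, hy, add_zero])
      (fun c x _ hx => by rw [inner_smul_right, hx, mul_zero]) hu
    rintro _ ⟨l, hl, rfl⟩
    have hl := Finset.mem_erase.1 (Finset.mem_coe.1 hl)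
    rw [inner_dualVector hX j ⟨l, hl.2⟩, if_neg]
    exact fun h => hl.1 (congrArg Subtype.val h).symm
  · rw [← Submodule.span_union, Set.singleton_union, ← Set.image_insert_eq, ← Finset.coe_insert,
      Finset.insert_erase j.2]
    exact dualVector_mem_span X T j

theorem dualVector_congr {X Y : ι → EuclideanSpace ℝ (Fin m)} {T : Finset ι}
    (h : ∀ l ∈ T, X l = Y l) (j : T) : dualVector X T j = dualVector Y T j := by
  have : columnMatrix X T = columnMatrix Y T := by
    ext k l
    simp [columnMatrix, h l l.2]
  rw [dualVector, dualVector, this]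

/-- The inverse is the adjugate divided by the determinant; this is measurable everywhere, also
where the determinant vanishes. -/
theorem measurable_dualVector [Finite ι] (T : Finset ι) (j : T) :
    Measurable fun X : ι → EuclideanSpace ℝ (Fin m) => dualVector X T j := by
  have hM : Continuous fun X : ι → EuclideanSpace ℝ (Fin m) => columnMatrix X T :=
    continuous_matrix fun k l => by simp only [columnMatrix, Matrix.of_apply]; fun_prop
  have hW := hM.matrix_transpose.matrix_mul hM
  have hinv : ∀ a b, Measurable fun X : ι → EuclideanSpace ℝ (Fin m) =>
      ((columnMatrix X T)ᵀ * columnMatrix X T)⁻¹ a b := fun a b => by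
    simp only [Matrix.inv_def, Matrix.smul_apply, Ring.inverse_eq_inv', smul_eq_mul]
    exact hW.matrix_det.measurable.inv.mul (hW.matrix_adjugate.matrix_elem a b).measurable
  refine (WithLp.measurable_toLp 2 _).comp (measurable_pi_lambda _ fun k => ?_)
  simp only [Matrix.mul_apply]
  exact Finset.measurable_sum _ fun l _ =>
    (hinv j l).mul (hM.matrix_transpose.matrix_elem l k).measurable

end ColumnMatrix

/-! ### Moments of linear forms in Gaussian vectors -/

section LinearForms

variable {ι : Type*} [Fintype ι] {E : Type*} [NormedAddCommGroup E]
  [InnerProductSpace ℝ E] [FiniteDimensional ℝ E] [MeasurableSpace E] [BorelSpace E]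

theorem memLp_inner_sum_smul (p : E) (T : Finset ι) (b : ι → ℝ) :
    MemLp (fun Y : ι → E => inner ℝ p (∑ l ∈ T, b l • Y l)) 2
      (Measure.pi fun _ => stdGaussian E) := by
  simp_rw [inner_sum, inner_smul_right]
  refine memLp_finsetSum _ fun l _ => MemLp.const_mul ?_ _
  have h : MemLp (innerSL ℝ p) 2 (stdGaussian E) := IsGaussian.memLp_dual _ _ _ (by simp)
  exact h.comp_measurePreserving (measurePreserving_eval (fun _ : ι => stdGaussian E) l)

theorem integral_inner_sum_smul (p : E) (T : Finset ι) (b : ι → ℝ) :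
    ∫ Y : ι → E, inner ℝ p (∑ l ∈ T, b l • Y l) ∂(Measure.pi fun _ => stdGaussian E) = 0 := by
  have h : MemLp (innerSL ℝ p) 1 (stdGaussian E) := IsGaussian.memLp_dual _ _ _ (by simp)
  simp_rw [inner_sum, inner_smul_right]
  rw [integral_finsetSum]
  · refine Finset.sum_eq_zero fun l _ => ?_
    rw [integral_const_mul]
    have := integral_comp_eval (μ := fun _ : ι => stdGaussian E) (i := l) (f := innerSL ℝ p)
      (by fun_prop)
    simp only [innerSL_apply_apply] at this
    rw [this]
    have h2 := integral_strongDual_stdGaussian (innerSL ℝ p)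
    simp only [innerSL_apply_apply] at h2
    rw [h2, mul_zero]
  · intro l _
    exact (integrable_comp_eval (μ := fun _ : ι => stdGaussian E) (i := l)
      (memLp_one_iff_integrable.1 h)).const_mul _

theorem integral_inner_sum_smul_sq (p : E) (T : Finset ι) (b : ι → ℝ) :
    ∫ Y : ι → E, inner ℝ p (∑ l ∈ T, b l • Y l) ^ 2 ∂(Measure.pi fun _ => stdGaussian E)
      = (∑ l ∈ T, b l ^ 2) * ‖p‖ ^ 2 := by
  classical
  rw [← variance_of_integral_eq_zero (memLp_inner_sum_smul p T b).aemeasurable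
    (integral_inner_sum_smul p T b)]
  -- The coefficients are extended by zero, so that the sum of independent terms runs over all of
  -- `ι`.
  have h := variance_sum_pi (μ := fun _ : ι => stdGaussian E)
    (X := fun l y => (if l ∈ T then b l else 0) * innerSL ℝ p y) (fun l => by
      refine MemLp.const_mul ?_ _
      exact IsGaussian.memLp_dual _ _ _ (by simp))
  have e : (fun Y : ι → E => inner ℝ p (∑ l ∈ T, b l • Y l))
      = ∑ l, fun Y : ι → E => (if l ∈ T then b l else 0) * innerSL ℝ p (Y l) := by
    ext Y
    simp [inner_sum, inner_smul_right, Finset.sum_ite_mem]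
  rw [e, h, Finset.sum_mul]
  simp_rw [variance_const_mul, variance_dual_stdGaussian, innerSL_apply_norm, ite_pow, ite_mul]
  simp [Finset.sum_ite_mem]

theorem lintegral_inner_sum_smul_sq (p : E) (T : Finset ι) (b : ι → ℝ) :
    ∫⁻ Y : ι → E, ENNReal.ofReal (inner ℝ p (∑ l ∈ T, b l • Y l) ^ 2)
        ∂(Measure.pi fun _ => stdGaussian E)
      = ENNReal.ofReal (∑ l ∈ T, b l ^ 2) * ENNReal.ofReal (‖p‖ ^ 2) := by
  rw [← ofReal_integral_eq_lintegral_ofReal (memLp_inner_sum_smul p T b).integrable_sq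
    (ae_of_all _ fun _ => sq_nonneg _), integral_inner_sum_smul_sq,
    ENNReal.ofReal_mul (Finset.sum_nonneg fun _ _ => sq_nonneg _)]

end LinearForms

/-! ### Moments of the least-squares error -/

section RecoveryError

variable {ι : Type*} [Fintype ι] [DecidableEq ι] {m : ℕ}

theorem lintegral_norm_sq_dualVector {T : Finset ι} (hT : T.card + 2 ≤ m) (j : T) :
    ∫⁻ X : ι → EuclideanSpace ℝ (Fin m), ENNReal.ofReal (‖dualVector X T j‖ ^ 2)
        ∂(Measure.pi fun _ => stdGaussian _)
      = ENNReal.ofReal ((m : ℝ) - T.card - 1)⁻¹ := by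
  have hmeas : Measurable fun X : ι → EuclideanSpace ℝ (Fin m) =>
      ENNReal.ofReal (‖dualVector X T j‖ ^ 2) :=
    ((measurable_dualVector T j).norm.pow_const 2).ennreal_ofReal
  have hmp := measurePreserving_piecewise (stdGaussian (EuclideanSpace ℝ (Fin m))) (T.erase j)
  -- Freeze the vectors indexed by `T.erase j`: their span `V` is then fixed and `X j` is a fresh
  -- Gaussian vector.
  rw [lintegral_pi_eq_lintegral_piecewise _ (T.erase j) hmeas]
  have hLI := Measure.ae_ae_of_ae_prod (hmp.quasiMeasurePreserving.ae
    (ae_linearIndepOn_pi_stdGaussian T (by simp; omega)))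
  have hconst : ∀ᵐ X : ι → EuclideanSpace ℝ (Fin m) ∂(Measure.pi fun _ => stdGaussian _),
      ∫⁻ Y : ι → EuclideanSpace ℝ (Fin m),
        ENNReal.ofReal (‖dualVector ((T.erase j).piecewise X Y) T j‖ ^ 2)
        ∂(Measure.pi fun _ => stdGaussian _) = ENNReal.ofReal ((m : ℝ) - T.card - 1)⁻¹ := by
    filter_upwards [hLI, ae_linearIndepOn_pi_stdGaussian (T.erase j)
      (E := EuclideanSpace ℝ (Fin m)) (by simp; omega)] with X hX hXj
    set V := Submodule.span ℝ (X '' (T.erase j : Set ι)) with hV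
    have hfV : Module.finrank ℝ V + 1 = T.card := by
      have h := finrank_span_eq_card (R := ℝ) (b := fun l : (T.erase j : Finset ι) => X l) hXj
      have hpos := Finset.card_pos.2 ⟨_, j.2⟩
      rw [Fintype.card_coe, Finset.card_erase_of_mem j.2] at h
      have h' : Module.finrank ℝ V = T.card - 1 := by
        rw [hV, Set.image_eq_range]
        exact h
      omega
    have hfVo := V.finrank_add_finrank_orthogonal
    rw [finrank_euclideanSpace_fin] at hfVo
    have hY : ∀ᵐ Y : ι → EuclideanSpace ℝ (Fin m) ∂(Measure.pi fun _ => stdGaussian _),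
        ENNReal.ofReal (‖dualVector ((T.erase j).piecewise X Y) T j‖ ^ 2)
          = ENNReal.ofReal (‖Vᗮ.orthogonalProjectionOnto (Y j)‖ ^ 2)⁻¹ := by
      filter_upwards [hX] with Y hXY
      have he : Set.EqOn ((T.erase j).piecewise X Y) X (T.erase j : Set ι) :=
        fun i hi => Finset.piecewise_eq_of_mem _ _ _ hi
      have hj : (T.erase j).piecewise X Y j = Y j :=
        Finset.piecewise_eq_of_notMem _ _ _ (Finset.notMem_erase _ _)
      rw [norm_sq_dualVector hXY, he.image_eq, hj]
    rw [lintegral_congr_ae hY,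
      (measurePreserving_eval (fun _ : ι => stdGaussian (EuclideanSpace ℝ (Fin m))) j).lintegral_comp
        (f := fun y => ENNReal.ofReal (‖Vᗮ.orthogonalProjectionOnto y‖ ^ 2)⁻¹) (by fun_prop),
      -- Here `Vᗮ` has dimension `m - |T| + 1`, which is at least `3` exactly when `|T| + 2 ≤ m`.
      lintegral_inv_norm_sq_orthogonalProjection _ (by omega)]
    congr 2
    have h1 : (Module.finrank ℝ V : ℝ) + 1 = T.card := by exact_mod_cast hfV
    have h2 : (Module.finrank ℝ V : ℝ) + Module.finrank ℝ Vᗮ = m := by exact_mod_cast hfVo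
    linarith
  rw [lintegral_congr_ae hconst]
  simp

/-- The error that least squares on the columns `X l`, `l ∈ T`, makes in its coefficient `j` when
the right-hand side is `∑ l, b l • X l`. -/
noncomputable def leastSquaresError (b : ι → ℝ) (T : Finset ι) (j : T)
    (X : ι → EuclideanSpace ℝ (Fin m)) : ℝ :=
  inner ℝ (dualVector X T j) (∑ l ∈ Tᶜ, b l • X l)

theorem measurable_leastSquaresError (b : ι → ℝ) (T : Finset ι) (j : T) :
    Measurable (leastSquaresError (m := m) b T j) :=
  (measurable_dualVector T j).inner (by fun_prop)

/-- Resampling outside `T` separates the two factors: the dual vector sees only `X`, the noise only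
`Y`. -/
theorem leastSquaresError_piecewise (b : ι → ℝ) (T : Finset ι) (j : T)
    (X Y : ι → EuclideanSpace ℝ (Fin m)) :
    leastSquaresError b T j (T.piecewise X Y)
      = inner ℝ (dualVector X T j) (∑ l ∈ Tᶜ, b l • Y l) := by
  rw [leastSquaresError, dualVector_congr (Y := X) fun l hl => Finset.piecewise_eq_of_mem _ _ _ hl]
  congr 1
  refine Finset.sum_congr rfl fun l hl => ?_
  rw [Finset.piecewise_eq_of_notMem _ _ _ (Finset.mem_compl.1 hl)]

theorem lintegral_leastSquaresError_sq {T : Finset ι} (hT : T.card + 2 ≤ m) (b : ι → ℝ) (j : T) :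
    ∫⁻ X, ENNReal.ofReal (leastSquaresError (m := m) b T j X ^ 2)
        ∂(Measure.pi fun _ => stdGaussian _)
      = ENNReal.ofReal ((∑ l ∈ Tᶜ, b l ^ 2) * ((m : ℝ) - T.card - 1)⁻¹) := by
  have hmeas := ((measurable_leastSquaresError (m := m) b T j).pow_const 2).ennreal_ofReal
  rw [lintegral_pi_eq_lintegral_piecewise _ T hmeas]
  simp_rw [leastSquaresError_piecewise, lintegral_inner_sum_smul_sq]
  rw [lintegral_const_mul _ ((measurable_dualVector T j).norm.pow_const 2).ennreal_ofReal,
    lintegral_norm_sq_dualVector hT,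
    ENNReal.ofReal_mul (Finset.sum_nonneg fun _ _ => sq_nonneg _)]

/-- The second moment was computed as a `lintegral`, so its finiteness yields the integrability that
the Bochner integrals below require. -/
theorem memLp_leastSquaresError {T : Finset ι} (hT : T.card + 2 ≤ m) (b : ι → ℝ) (j : T) :
    MemLp (leastSquaresError (m := m) b T j) 2 (Measure.pi fun _ => stdGaussian _) := by
  have hmeas := measurable_leastSquaresError (m := m) b T j
  rw [memLp_two_iff_integrable_sq hmeas.aestronglyMeasurable]
  refine ⟨(hmeas.pow_const 2).aestronglyMeasurable, ?_⟩
  rw [hasFiniteIntegral_iff_ofReal (ae_of_all _ fun _ => sq_nonneg _),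
    lintegral_leastSquaresError_sq hT]
  exact ENNReal.ofReal_lt_top

theorem integral_leastSquaresError_sq {T : Finset ι} (hT : T.card + 2 ≤ m) (b : ι → ℝ) (j : T) :
    ∫ X, leastSquaresError (m := m) b T j X ^ 2 ∂(Measure.pi fun _ => stdGaussian _)
      = (∑ l ∈ Tᶜ, b l ^ 2) * ((m : ℝ) - T.card - 1)⁻¹ := by
  have hpos : (0 : ℝ) ≤ (m : ℝ) - T.card - 1 := by
    have : (T.card : ℝ) + 2 ≤ m := by exact_mod_cast hT
    linarith
  rw [integral_eq_lintegral_of_nonneg_ae (ae_of_all _ fun _ => sq_nonneg _)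
    ((measurable_leastSquaresError b T j).pow_const 2).aestronglyMeasurable,
    lintegral_leastSquaresError_sq hT, ENNReal.toReal_ofReal
    (mul_nonneg (Finset.sum_nonneg fun _ _ => sq_nonneg _) (inv_nonneg.2 hpos))]

theorem integral_leastSquaresError {T : Finset ι} (hT : T.card + 2 ≤ m) (b : ι → ℝ) (j : T) :
    ∫ X, leastSquaresError (m := m) b T j X ∂(Measure.pi fun _ => stdGaussian _) = 0 := by
  have hint := (memLp_leastSquaresError hT b j).integrable one_le_two
  rw [integral_pi_eq_integral_piecewise _ T hint]
  simp_rw [leastSquaresError_piecewise, integral_inner_sum_smul]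
  simp

end RecoveryError

/-! ### From Gaussian rows to the algorithm -/

theorem MatVecAlg.queryCount_queryColumns {n d : ℕ} {α : Type} (A : Matrix (Fin n) (Fin d) ℝ)
    (m : ℕ) (G : Matrix (Fin d) (Fin m) ℝ) (post : Matrix (Fin n) (Fin m) ℝ → α) :
    (MatVecAlg.queryColumns m G post).queryCount A = m := by
  induction m with
  | zero => rfl
  | succ m ih => simp only [MatVecAlg.queryColumns, MatVecAlg.queryCount, ih]

theorem Matrix.frobenius_norm_sq {n d : ℕ} (M : Matrix (Fin n) (Fin d) ℝ) :
    ‖M‖ ^ 2 = ∑ i, ∑ j, M i j ^ 2 := by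
  rw [Matrix.frobenius_norm_def, ← Real.sqrt_eq_rpow, Real.sq_sqrt (by positivity)]
  simp

theorem map_rows_pi_gaussianReal (d m : ℕ) :
    (Measure.pi fun _ : Fin d × Fin m => gaussianReal 0 1).map
        (fun g (j : Fin d) => WithLp.toLp 2 fun k => g (j, k))
      = Measure.pi fun _ : Fin d => stdGaussian (EuclideanSpace ℝ (Fin m)) := by
  have hcurry : (Measure.pi fun _ : Fin d × Fin m => gaussianReal 0 1).map
      (MeasurableEquiv.curry (Fin d) (Fin m) ℝ)
      = Measure.pi fun _ : Fin d => Measure.pi fun _ : Fin m => gaussianReal 0 1 := by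
    have h := Measure.infinitePi_map_curry (fun (_ : Fin d) (_ : Fin m) => gaussianReal 0 1)
    simpa only [Measure.infinitePi_eq_pi] using h
  simp_rw [← map_pi_eq_stdGaussian]
  have : IsProbabilityMeasure ((Measure.pi fun _ : Fin m => gaussianReal 0 1).map
      (WithLp.toLp 2)) := Measure.isProbabilityMeasure_map (by fun_prop)
  rw [← Measure.pi_map_pi (fun _ => by fun_prop), ← hcurry,
    Measure.map_map (by fun_prop) (by fun_prop)]
  rfl

theorem IsGaussianMatrix.hasLaw_rows {Ω : Type*} [MeasurableSpace Ω] {P : Measure Ω}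
    [IsProbabilityMeasure P] {d m : ℕ} {G : Ω → Matrix (Fin d) (Fin m) ℝ}
    (hG : IsGaussianMatrix P G) :
    HasLaw (fun ω (j : Fin d) => WithLp.toLp 2 (G ω j))
      (Measure.pi fun _ => stdGaussian (EuclideanSpace ℝ (Fin m))) P := by
  have hae : ∀ p : Fin d × Fin m, AEMeasurable (fun ω => G ω p.1 p.2) P :=
    fun p => (hG.1 p.1 p.2).aemeasurable
  have hae' : AEMeasurable (fun ω (p : Fin d × Fin m) => G ω p.1 p.2) P :=
    aemeasurable_pi_lambda _ hae
  have h := (iIndepFun_iff_map_fun_eq_pi_map hae).1 hG.2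
  simp_rw [(hG.1 _ _).map_eq] at h
  have hf : Measurable fun (g : Fin d × Fin m → ℝ) (j : Fin d) =>
      (WithLp.toLp 2 fun k => g (j, k) : EuclideanSpace ℝ (Fin m)) := by fun_prop
  refine ⟨hf.comp_aemeasurable hae', ?_⟩
  rw [← map_rows_pi_gaussianReal, ← h, AEMeasurable.map_map_of_aemeasurable hf.aemeasurable hae']
  rfl

/-- Split `∑ l, A i l • X l` at `S_i`: by duality the part inside contributes exactly `A i j`, and
the part outside is the error. -/
theorem solveRows_mul_apply {n d m : ℕ} (S A : Matrix (Fin n) (Fin d) ℝ)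
    (G : Matrix (Fin d) (Fin m) ℝ) {i : Fin n}
    (hX : LinearIndepOn ℝ (fun j => (WithLp.toLp 2 (G j) : EuclideanSpace ℝ (Fin m)))
      (rowSupport S i : Set (Fin d))) (j : rowSupport S i) :
    solveRows S G (A * G) i j = A i j
      + leastSquaresError (A i) (rowSupport S i) j (fun j => WithLp.toLp 2 (G j)) := by
  set X : Fin d → EuclideanSpace ℝ (Fin m) := fun j => WithLp.toLp 2 (G j)
  have hz : WithLp.toLp 2 ((A * G) i) = ∑ l, A i l • X l := by
    ext k
    simp [X, Matrix.mul_apply]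
  have h1 : solveRows S G (A * G) i j
      = inner ℝ (dualVector X (rowSupport S i) j) (WithLp.toLp 2 ((A * G) i)) := by
    rw [dualVector_eq_pinv hX]
    simp only [solveRows, Matrix.of_apply, PiLp.inner_apply]
    rw [dif_pos j.2]
    simp only [Matrix.mulVec, dotProduct]
    exact Finset.sum_congr rfl fun k _ => mul_comm _ _
  rw [h1, hz, ← Finset.sum_add_sum_compl (rowSupport S i), inner_add_right, leastSquaresError]
  congr 1
  rw [← Finset.sum_coe_sort (rowSupport S i), inner_sum]
  simp_rw [inner_smul_right, inner_dualVector hX]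
  simp

/-- The entrywise error of the recovery algorithm, as a function of the rows of the sketching
matrix. -/
noncomputable def recoveryError {n d m : ℕ} (S A : Matrix (Fin n) (Fin d) ℝ) (i : Fin n)
    (j : Fin d) (X : Fin d → EuclideanSpace ℝ (Fin m)) : ℝ :=
  if h : j ∈ rowSupport S i then leastSquaresError (A i) (rowSupport S i) ⟨j, h⟩ X else 0

section RecoveryErrorMoments

variable {n d m : ℕ} (S A : Matrix (Fin n) (Fin d) ℝ) {i : Fin n}

theorem memLp_recoveryError (hT : (rowSupport S i).card + 2 ≤ m) (j : Fin d) :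
    MemLp (recoveryError (m := m) S A i j) 2 (Measure.pi fun _ => stdGaussian _) := by
  unfold recoveryError
  by_cases h : j ∈ rowSupport S i
  · simpa only [h, dite_true] using memLp_leastSquaresError hT (A i) ⟨j, h⟩
  · simp [h]

theorem integral_recoveryError (hT : (rowSupport S i).card + 2 ≤ m) (j : Fin d) :
    ∫ X, recoveryError (m := m) S A i j X ∂(Measure.pi fun _ => stdGaussian _) = 0 := by
  unfold recoveryError
  by_cases h : j ∈ rowSupport S i
  · simpa only [h, dite_true] using integral_leastSquaresError hT (A i) ⟨j, h⟩
  · simp [h]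

/-- Every `j ∈ S_i` has the same mean squared error, hence the factor `|S_i|`. -/
theorem sum_integral_recoveryError_sq (hT : (rowSupport S i).card + 2 ≤ m) :
    ∑ j, ∫ X, recoveryError (m := m) S A i j X ^ 2 ∂(Measure.pi fun _ => stdGaussian _)
      = ((rowSupport S i).card : ℝ) / ((m : ℝ) - (rowSupport S i).card - 1)
        * ∑ l ∈ (rowSupport S i)ᶜ, A i l ^ 2 := by
  have h : ∀ j, ∫ X, recoveryError (m := m) S A i j X ^ 2 ∂(Measure.pi fun _ => stdGaussian _)
      = if j ∈ rowSupport S i then (∑ l ∈ (rowSupport S i)ᶜ, A i l ^ 2)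
        * ((m : ℝ) - (rowSupport S i).card - 1)⁻¹ else 0 := by
    intro j
    unfold recoveryError
    by_cases h : j ∈ rowSupport S i
    · simpa only [h, dite_true, if_true] using integral_leastSquaresError_sq hT (A i) ⟨j, h⟩
    · simp [h]
  simp_rw [h, Finset.sum_ite_mem, Finset.univ_inter, Finset.sum_const, nsmul_eq_mul]
  ring

end RecoveryErrorMoments

theorem rowSupport_eq_filter_ne_zero {n d : ℕ} {S : Matrix (Fin n) (Fin d) ℝ}
    (hS : ∀ i j, S i j = 0 ∨ S i j = 1) (i : Fin n) :
    rowSupport S i = Finset.univ.filter fun j => S i j ≠ 0 := by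
  ext j
  rcases hS i j with h | h <;> simp [rowSupport, h]

theorem solveRows_mul_eq_hadamard_add_recoveryError {n d m : ℕ} {S : Matrix (Fin n) (Fin d) ℝ}
    (hS : ∀ i j, S i j = 0 ∨ S i j = 1) (A : Matrix (Fin n) (Fin d) ℝ)
    (G : Matrix (Fin d) (Fin m) ℝ) {i : Fin n}
    (hX : LinearIndepOn ℝ (fun j => (WithLp.toLp 2 (G j) : EuclideanSpace ℝ (Fin m)))
      (rowSupport S i : Set (Fin d))) (j : Fin d) :
    solveRows S G (A * G) i j
      = (S ⊙ A) i j + recoveryError S A i j fun j => WithLp.toLp 2 (G j) := by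
  by_cases h : j ∈ rowSupport S i
  · have h1 : S i j = 1 := by simpa [rowSupport] using h
    rw [solveRows_mul_apply S A G hX ⟨j, h⟩]
    simp [recoveryError, h, h1]
  · have h1 : S i j = 0 := by
      simp only [rowSupport, Finset.mem_filter, Finset.mem_univ, true_and] at h
      exact (hS i j).resolve_right h
    simp [recoveryError, h, solveRows, h1]

theorem frobenius_norm_sq_sub_hadamard {n d : ℕ} {S : Matrix (Fin n) (Fin d) ℝ}
    (hS : ∀ i j, S i j = 0 ∨ S i j = 1) (A : Matrix (Fin n) (Fin d) ℝ) :
    ‖A - S ⊙ A‖ ^ 2 = ∑ i, ∑ l ∈ (rowSupport S i)ᶜ, A i l ^ 2 := by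
  rw [Matrix.frobenius_norm_sq]
  refine Finset.sum_congr rfl fun i _ => ?_
  rw [← Finset.sum_filter_add_sum_filter_not _ (· ∈ (rowSupport S i)ᶜ)]
  rw [Finset.filter_univ_mem]
  rw [Finset.sum_eq_zero (s := Finset.univ.filter _)
    (fun l hl => by
      have : S i l = 1 := by simpa [rowSupport] using hl
      simp [this]), add_zero]
  refine Finset.sum_congr rfl fun l hl => ?_
  have : S i l = 0 := (hS i l).resolve_right (by simpa [rowSupport] using hl)
  simp [this]

theorem theorem1 {n d m s : ℕ}
    (A S : Matrix (Fin n) (Fin d) ℝ)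
    (hS : ∀ i j, S i j = 0 ∨ S i j = 1)
    (hs : ∀ i, (Finset.univ.filter fun j => S i j ≠ 0).card ≤ s)
    (hm : s + 2 ≤ m)
    {Ω : Type*} [MeasurableSpace Ω] (P : Measure Ω) [IsProbabilityMeasure P]
    (G : Ω → Matrix (Fin d) (Fin m) ℝ) (hG : IsGaussianMatrix P G)
    (At : Ω → Matrix (Fin n) (Fin d) ℝ)
    (hAt : ∀ ω, At ω = (fixedSparseRecovery S (G ω)).output A) :
    (∀ ω, (fixedSparseRecovery S (G ω)).queryCount A = m) ∧
    (∀ i j, Integrable (fun ω => At ω i j) P ∧ ∫ ω, At ω i j ∂P = (S ⊙ A) i j) ∧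
    Integrable (fun ω => ‖S ⊙ A - At ω‖ ^ 2) P ∧
    ∫ ω, ‖S ⊙ A - At ω‖ ^ 2 ∂P ≤ (s : ℝ) / ((m : ℝ) - s - 1) * ‖A - S ⊙ A‖ ^ 2 ∧
    ((∀ i, (Finset.univ.filter fun j => S i j ≠ 0).card = s) →
      ∫ ω, ‖S ⊙ A - At ω‖ ^ 2 ∂P = (s : ℝ) / ((m : ℝ) - s - 1) * ‖A - S ⊙ A‖ ^ 2) := by
  have hlaw := hG.hasLaw_rows
  set X : Ω → Fin d → EuclideanSpace ℝ (Fin m) := fun ω j => WithLp.toLp 2 (G ω j)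
  simp_rw [← rowSupport_eq_filter_ne_zero hS] at hs ⊢
  have hT : ∀ i, (rowSupport S i).card + 2 ≤ m := fun i => by have := hs i; omega
  have hLI : ∀ᵐ ω ∂P, ∀ i, LinearIndepOn ℝ (X ω) (rowSupport S i : Set (Fin d)) := by
    refine ae_all_iff.2 fun i => ae_of_ae_map
      (p := fun X => LinearIndepOn ℝ X (rowSupport S i : Set (Fin d))) hlaw.aemeasurable ?_
    rw [hlaw.map_eq]
    exact ae_linearIndepOn_pi_stdGaussian _ (by have := hT i; simp; omega)
  have hAtE : ∀ᵐ ω ∂P, ∀ i j, At ω i j = (S ⊙ A) i j + recoveryError S A i j (X ω) := by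
    filter_upwards [hLI] with ω hω i j
    rw [hAt, fixedSparseRecovery, MatVecAlg.output_queryColumns]
    exact solveRows_mul_eq_hadamard_add_recoveryError hS A (G ω) (hω i) j
  have hmem : ∀ i j, MemLp (fun ω => recoveryError S A i j (X ω)) 2 P := fun i j => by
    have h := memLp_recoveryError S A (hT i) j
    rw [← hlaw.map_eq] at h
    exact h.comp_of_map hlaw.aemeasurable
  have hsq : (fun ω => ‖S ⊙ A - At ω‖ ^ 2)
      =ᵐ[P] fun ω => ∑ i, ∑ j, recoveryError S A i j (X ω) ^ 2 := by
    filter_upwards [hAtE] with ω hω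
    rw [Matrix.frobenius_norm_sq]
    simp [hω]
  have hint : ∫ ω, ‖S ⊙ A - At ω‖ ^ 2 ∂P = ∑ i, ((rowSupport S i).card : ℝ)
      / ((m : ℝ) - (rowSupport S i).card - 1) * ∑ l ∈ (rowSupport S i)ᶜ, A i l ^ 2 := by
    rw [integral_congr_ae hsq, integral_finsetSum _ fun i _ =>
      integrable_finsetSum _ fun j _ => (hmem i j).integrable_sq]
    refine Finset.sum_congr rfl fun i _ => ?_
    rw [integral_finsetSum _ fun j _ => (hmem i j).integrable_sq,
      ← sum_integral_recoveryError_sq S A (hT i)]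
    refine Finset.sum_congr rfl fun j _ => ?_
    exact hlaw.integral_comp ((memLp_recoveryError S A (hT i) j).aestronglyMeasurable.pow 2)
  refine ⟨fun ω => MatVecAlg.queryCount_queryColumns A m _ _, fun i j => ?_, ?_, ?_, fun h => ?_⟩
  · have he : (fun ω => At ω i j) =ᵐ[P] fun ω => (S ⊙ A) i j + recoveryError S A i j (X ω) :=
      hAtE.mono fun ω hω => hω i j
    have hi := (hmem i j).integrable one_le_two
    refine ⟨((integrable_const _).add hi).congr he.symm, ?_⟩
    have h0 := hlaw.integral_comp (memLp_recoveryError S A (hT i) j).aestronglyMeasurable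
    rw [integral_recoveryError S A (hT i)] at h0
    have h0' : ∫ ω, recoveryError S A i j (X ω) ∂P = 0 := h0
    rw [integral_congr_ae he, integral_add (integrable_const _) hi, h0']
    simp
  -- Without integrability the Bochner integral would be `0` by default and the bound void.
  · exact (integrable_finsetSum _ fun i _ =>
      integrable_finsetSum _ fun j _ => (hmem i j).integrable_sq).congr hsq.symm
  · rw [hint, frobenius_norm_sq_sub_hadamard hS, Finset.mul_sum]
    refine Finset.sum_le_sum fun i _ => ?_
    refine mul_le_mul_of_nonneg_right ?_ (Finset.sum_nonneg fun _ _ => sq_nonneg _)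
    have h1 : ((rowSupport S i).card : ℝ) ≤ s := by exact_mod_cast hs i
    have h2 : (s : ℝ) + 2 ≤ m := by exact_mod_cast hm
    -- Passing from `|S_i|` to `s` enlarges the numerator and shrinks the denominator, which stays
    -- at least `1`.
    exact div_le_div₀ (Nat.cast_nonneg s) h1 (by linarith) (by linarith)
  · rw [hint, frobenius_norm_sq_sub_hadamard hS, Finset.mul_sum]
    simp_rw [h]
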